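/- Let $(\Omega,\mathcal F,P)$ be a probability space, let $L^p=L^p(\Omega,\mathcal F,P)$ for $p\in\{1,\infty\}$, and let $\mathcal M_1(P)$ be the set of all probability measures on $(\Omega,\mathcal F)$ that are absolutely continuous with respect to $P$. Let $\rho:L^\infty\to\mathbb R$ be - convex: $\rho(\alpha X+(1-\alpha)Y)\le\alpha\rho(X)+(1-\alpha)\rho(Y)$ for all $X,Y\in L^\infty$, $\alpha\in[0,1]$; - monotone: $X\le Y$ $P$-a.s. implies $\rho(X)\ge\rho(Y)$; - cash-subadditive: $\rho(X+m)\ge\rho(X)-m$ for all $X\in L^\infty$ and all constants $m\ge 0$; - normalized: $\rho(0)=0$. Then the following are equivalent: (i) $\rho$ is continuous from above: if $X_n,X\in L^\infty$ and $X_n\downarrow X$ $P$-a.s., then $\lim_n\rho(X_n)=\rho(X)$. (ii) $\rho$ is lower semicontinuous with respect to the topology $\sigma(L^\infty,L^1)$. (iii) There is a set $\mathcal Q\subseteq\mathcal M_1(P)$ such that $$\rho(X)=\sup_{a\in[0,1],\,Q\in\mathcal Q}\{a\,\mathbb E_Q[-X]-\bar c(aQ)\}\qquad\text{for all }X\in L^\infty,$$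 where the minimal penalty function $\bar c:[0,1]\times\mathcal Q\to[0,+\infty]$ is defined by $\bar c(aQ)=\sup_{X\in L^\infty}\{a\,\mathbb E_Q[-X]-\rho(X)\}$. (iv) There are a set $\mathcal Q\subseteq\mathcal M_1(P)$ and a function $c:[0,1]\times\mathcal Q\to[0,+\infty]$, whose value at $(a,Q)$ is written $c(aQ)$, such that $$\rho(X)=\sup_{a\in[0,1],\,Q\in\mathcal Q}\{a\,\mathbb E_Q[-X]-c(aQ)\}\qquad\text{for all }X\in L^\infty.$$ -/

import Mathlib

open MeasureTheory Filter Topology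
open scoped ENNReal

noncomputable section

namespace RiskMeasure

variable {Ω : Type*} [MeasurableSpace Ω]

/-- The space `L^∞(Ω, 𝓕, P)` of (classes of) essentially bounded random variables; its order `≤` is
the `P`-almost sure one. -/
abbrev Linfty (P : Measure Ω) := Lp ℝ ∞ P

/-- The pairing `(X, Z) ↦ ∫ X Z dP` between `L^∞` and `L^1`. -/
def pairing (P : Measure Ω) : Linfty P →ₗ[ℝ] Lp ℝ 1 P →ₗ[ℝ] ℝ :=
  ((ContinuousLinearMap.mul ℝ ℝ).lpPairing P ∞ 1).toLinearMap₁₂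

theorem pairing_apply (P : Measure Ω) (X : Linfty P) (Z : Lp ℝ 1 P) :
    pairing P X Z = ∫ ω, X ω * Z ω ∂P := by
  simp [pairing, ContinuousLinearMap.lpPairing_eq_integral]

/-- Lower semicontinuity of `ρ` with respect to the topology `σ(L^∞, L^1)`. -/
def WeakStarLSC (P : Measure Ω) (ρ : Linfty P → ℝ) : Prop :=
  LowerSemicontinuous (fun X : WeakBilin (pairing P) => ρ X)

/-- Cash-subadditivity: `ρ (X + m) ≥ ρ X - m` for every constant `m ≥ 0`. -/
def CashSubadditive (P : Measure Ω) [IsFiniteMeasure P] (ρ : Linfty P → ℝ) : Prop :=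
  ∀ (X : Linfty P) (m : ℝ), 0 ≤ m → ρ X - m ≤ ρ (X + Lp.const ∞ P m)

/-- Continuity from above: `ρ (X_n) → ρ X` whenever `X_n` decreases to `X`, `P`-almost surely. -/
def ContinuousFromAbove (P : Measure Ω) (ρ : Linfty P → ℝ) : Prop :=
  ∀ (Xn : ℕ → Linfty P) (X : Linfty P), (∀ n, Xn (n + 1) ≤ Xn n) →
    (∀ᵐ ω ∂P, Tendsto (fun n => Xn n ω) atTop (𝓝 (X ω))) →
    Tendsto (fun n => ρ (Xn n)) atTop (𝓝 (ρ X))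

/-- The set `M_1(P)` of probability measures that are absolutely continuous with respect to `P`. -/
def M1 (P : Measure Ω) : Set (Measure Ω) :=
  {Q | IsProbabilityMeasure Q ∧ Q ≪ P}

/-- The minimal penalty `c̄(aQ) = sup_X { a E_Q[-X] - ρ(X) }`, with values in `[-∞, +∞]`. -/
def minimalPenalty (P : Measure Ω) (ρ : Linfty P → ℝ) (a : ℝ) (Q : Measure Ω) : EReal :=
  ⨆ X : Linfty P, ((a * (∫ ω, -(X ω) ∂Q) - ρ X : ℝ) : EReal)

/-- `c` is a penalty function `[0,1] × 𝒬 → [0, +∞]` (its values elsewhere play no role), and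
`ρ(X) = sup { a E_Q[-X] - c(aQ) : a ∈ [0,1], Q ∈ 𝒬 }` for all `X ∈ L^∞`. -/
def RepresentedBy (P : Measure Ω) (ρ : Linfty P → ℝ) (𝒬 : Set (Measure Ω))
    (c : ℝ → Measure Ω → EReal) : Prop :=
  (∀ a ∈ Set.Icc (0 : ℝ) 1, ∀ Q ∈ 𝒬, 0 ≤ c a Q) ∧
  ∀ X : Linfty P, (ρ X : EReal) =
    ⨆ a ∈ Set.Icc (0 : ℝ) 1, ⨆ Q ∈ 𝒬, (((a * ∫ ω, -(X ω) ∂Q : ℝ) : EReal) - c a Q)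

end RiskMeasure

end

open MeasureTheory Filter Topology
open scoped ENNReal

noncomputable section

namespace RiskMeasure

/-! The analytic core is that continuity from above already yields affine minorants given by
elements of L^1. By monotonicity, tail suprema turn it into the Fatou property `BoundedLSC`. A
Krein–Šmulian argument (`exists_forall_le_add_pairing`), carried out in the Hilbert space L^2, then
produces for every `X` and `ε > 0` an ε-subgradient `-Z` of `ρ` at `X` with `Z` in L^1. Monotonicity
forces `Z ≥ 0` and cash-subadditivity forces `∫ Z ≤ 1`, so `Z = a dQ/dP`; letting `ε` tend to 0
gives the dual formula with the minimal penalty.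

Conversely, a supremum of σ(L^∞, L^1)-continuous affine functions is lower semicontinuous. Dominated
convergence makes decreasing sequences converge in that topology, where lower semicontinuity and
monotonicity bound the limit from both sides. -/

variable {Ω : Type*} [MeasurableSpace Ω]

/-! ### Nested convex sets in a Hilbert space -/

/-- A decreasing sequence of nonempty bounded convex sets in a Hilbert space has a common closure
point. -/
theorem exists_mem_iInter_closure_of_convex {H : Type*} [NormedAddCommGroup H]
    [InnerProductSpace ℝ H] [CompleteSpace H] (S : ℕ → Set H) (hconv : ∀ n, Convex ℝ (S n))
    (hne : ∀ n, (S n).Nonempty) (hanti : Antitone S) (R : ℝ) (hbdd : ∀ x ∈ S 0, ‖x‖ ≤ R) :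
    ∃ p, ∀ n, p ∈ closure (S n) := by
  have hmin : ∀ n, ∃ p ∈ closure (S n), ∀ q ∈ closure (S n), ‖p‖ ≤ ‖q‖ := by
    intro n
    obtain ⟨p, hp, hpe⟩ := exists_norm_eq_iInf_of_complete_convex (hne n).closure
      isClosed_closure.isComplete (hconv n).closure 0
    refine ⟨p, hp, fun q hq => ?_⟩
    have h : ‖(0 : H) - p‖ ≤ ‖(0 : H) - q‖ := by
      rw [hpe]
      exact ciInf_le ⟨0, by rintro _ ⟨w, rfl⟩; exact norm_nonneg _⟩ (⟨q, hq⟩ : closure (S n))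
    simpa using h
  choose p hp hpm using hmin
  have hcl : ∀ {m n}, n ≤ m → closure (S m) ⊆ closure (S n) := fun h => closure_mono (hanti h)
  have hmono : Monotone fun n => ‖p n‖ := fun n m h => hpm n _ (hcl h (hp m))
  have hbd : ∀ n, ‖p n‖ ≤ R := by
    intro n
    have : closure (S 0) ⊆ Metric.closedBall 0 R :=
      closure_minimal (fun x hx => by simpa using hbdd x hx) Metric.isClosed_closedBall
    simpa using this (hcl (Nat.zero_le n) (hp n))
  have hlim : Tendsto (fun n => ‖p n‖) atTop (𝓝 (⨆ n, ‖p n‖)) :=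
    tendsto_atTop_ciSup hmono ⟨R, by rintro _ ⟨n, rfl⟩; exact hbd n⟩
  have hle : ∀ n, ‖p n‖ ≤ ⨆ n, ‖p n‖ := le_ciSup ⟨R, by rintro _ ⟨n, rfl⟩; exact hbd n⟩
  -- The midpoint of `p n` and `p m` lies in `closure (S n)`, so its norm is at least `‖p n‖`; the
  -- parallelogram law turns convergence of the norms into the Cauchy property.
  have key : ∀ n m, n ≤ m → dist (p n) (p m) ^ 2 ≤ 4 * ((⨆ n, ‖p n‖) ^ 2 - ‖p n‖ ^ 2) := by
    intro n m h
    have hmid : (1 / 2 : ℝ) • p n + (1 / 2 : ℝ) • p m ∈ closure (S n) :=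
      (hconv n).closure (hp n) (hcl h (hp m)) (by norm_num) (by norm_num) (by norm_num)
    have h1 := hpm n _ hmid
    rw [← smul_add, norm_smul] at h1
    have h2 := parallelogram_law_with_norm ℝ (p n) (p m)
    rw [dist_eq_norm]
    have h3 := hle n
    have h4 := hle m
    have h0 := norm_nonneg (p n)
    have h0' := norm_nonneg (p m)
    have h5 : 2 * ‖p n‖ ≤ ‖p n + p m‖ := by
      norm_num at h1
      linarith
    have h6 := mul_self_le_mul_self (by positivity) h5
    have h7 := mul_self_le_mul_self h0' h4
    have h8 := mul_self_le_mul_self h0 h3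
    nlinarith
  have hcauchy : CauchySeq p := by
    refine Metric.cauchySeq_iff'.2 fun ε hε => ?_
    have hl : Tendsto (fun n => 4 * ((⨆ n, ‖p n‖) ^ 2 - ‖p n‖ ^ 2)) atTop (𝓝 0) := by
      convert ((hlim.pow 2).const_sub ((⨆ n, ‖p n‖) ^ 2)).const_mul 4 using 2
      ring
    obtain ⟨N, hN⟩ := (hl.eventually (gt_mem_nhds (pow_pos hε 2))).exists
    refine ⟨N, fun n hn => ?_⟩
    rw [dist_comm]
    exact lt_of_pow_lt_pow_left₀ 2 hε.le ((key N n hn).trans_lt hN)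
  obtain ⟨q, hq⟩ := cauchySeq_tendsto_of_complete hcauchy
  refine ⟨q, fun n => isClosed_closure.mem_of_tendsto hq ?_⟩
  filter_upwards [eventually_ge_atTop n] with m hm using hcl hm (hp m)

/-! ### The pairing of L^∞ and L^1 -/

theorem ae_abs_le_norm {P : Measure Ω} (X : Linfty P) : ∀ᵐ ω ∂P, |X ω| ≤ ‖X‖ := by
  have h := ae_le_eLpNormEssSup (f := (X : Ω → ℝ)) (μ := P)
  rw [← eLpNorm_exponent_top] at h
  filter_upwards [h] with ω hω
  have := ENNReal.toReal_mono (Lp.eLpNorm_ne_top X) hω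
  simpa [Lp.norm_def] using this

theorem norm_le_of_ae_abs_le {P : Measure Ω} {X : Linfty P} {C : ℝ} (hC : 0 ≤ C)
    (h : ∀ᵐ ω ∂P, |X ω| ≤ C) : ‖X‖ ≤ C := by
  rw [Lp.norm_def, eLpNorm_exponent_top]
  exact ENNReal.toReal_le_of_le_ofReal hC (eLpNormEssSup_le_of_ae_bound h)

theorem exists_linfty_of_ae_abs_le {P : Measure Ω} {f : Ω → ℝ} {C : ℝ}
    (hf : AEStronglyMeasurable f P) (h : ∀ᵐ ω ∂P, |f ω| ≤ C) : ∃ X : Linfty P, X =ᵐ[P] f :=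
  ⟨(memLp_top_of_bound hf C h).toLp f, MemLp.coeFn_toLp _⟩

theorem continuous_pairing_right (P : Measure Ω) (X : Linfty P) :
    Continuous fun Z => pairing P X Z :=
  ((ContinuousLinearMap.mul ℝ ℝ).lpPairing P ∞ 1 X).continuous

theorem integrable_mul (P : Measure Ω) (X : Linfty P) (Z : Lp ℝ 1 P) :
    Integrable (fun ω => X ω * Z ω) P :=
  (L1.integrable_coeFn Z).bdd_mul (Lp.aestronglyMeasurable X) (ae_abs_le_norm X)

/-- Bounded almost surely convergent sequences converge for `σ(L^∞, L^1)`. -/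
theorem tendsto_pairing {P : Measure Ω} {Xn : ℕ → Linfty P} {X : Linfty P} {R : ℝ}
    (hR : ∀ n, ∀ᵐ ω ∂P, |Xn n ω| ≤ R)
    (hX : ∀ᵐ ω ∂P, Tendsto (fun n => Xn n ω) atTop (𝓝 (X ω))) (Z : Lp ℝ 1 P) :
    Tendsto (fun n => pairing P (Xn n) Z) atTop (𝓝 (pairing P X Z)) := by
  simp only [pairing_apply]
  refine tendsto_integral_of_dominated_convergence (fun ω => R * |Z ω|)
    (fun n => (integrable_mul P (Xn n) Z).aestronglyMeasurable)
    ((L1.integrable_coeFn Z).abs.const_mul R) (fun n => ?_) ?_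
  · filter_upwards [hR n] with ω hω
    rw [Real.norm_eq_abs, abs_mul]
    gcongr
  · filter_upwards [hX] with ω hω using hω.mul_const _

/-! ### The Fatou property -/

/-- Lower semicontinuity along bounded almost surely convergent sequences. -/
def BoundedLSC (P : Measure Ω) (f : Linfty P → ℝ) : Prop :=
  ∀ (R : ℝ) (Xn : ℕ → Linfty P) (X : Linfty P) (cn : ℕ → ℝ) (c : ℝ), (∀ n, ‖Xn n‖ ≤ R) →
    (∀ᵐ ω ∂P, Tendsto (fun n => Xn n ω) atTop (𝓝 (X ω))) → (∀ n, f (Xn n) ≤ cn n) →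
    Tendsto cn atTop (𝓝 c) → f X ≤ c

/-- The pairing converges along the sequence, so it can be absorbed into the bounds `cn`; this is
why the definition lets the bounds vary. -/
theorem BoundedLSC.add_pairing {P : Measure Ω} {f : Linfty P → ℝ} (hf : BoundedLSC P f)
    (Z : Lp ℝ 1 P) : BoundedLSC P fun X => f X + pairing P X Z := by
  intro R Xn X cn c hR hX hc hcn
  have h := tendsto_pairing (P := P) (R := R) (fun n => by
    filter_upwards [ae_abs_le_norm (Xn n)] with ω hω using hω.trans (hR n)) hX Z
  have := hf R Xn X _ _ hR hX (fun n => le_sub_iff_add_le.2 (hc n)) (hcn.sub h)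
  exact le_sub_iff_add_le.1 this

/-- A monotone functional that is continuous from above has the Fatou property. -/
theorem ContinuousFromAbove.boundedLSC {P : Measure Ω} {ρ : Linfty P → ℝ}
    (h : ContinuousFromAbove P ρ) (hmono : ∀ X Y : Linfty P, X ≤ Y → ρ Y ≤ ρ X) :
    BoundedLSC P ρ := by
  intro R Xn X cn c hR hX hc hcn
  have hb : ∀ᵐ ω ∂P, ∀ n, |Xn n ω| ≤ R := by
    refine ae_all_iff.2 fun n => ?_
    filter_upwards [ae_abs_le_norm (Xn n)] with ω hω using hω.trans (hR n)
  have hbdd : ∀ ω, (∀ n, |Xn n ω| ≤ R) → ∀ n, BddAbove (Set.range fun m => Xn (n + m) ω) :=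
    fun ω hω n => ⟨R, by rintro _ ⟨m, rfl⟩; exact (abs_le.1 (hω _)).2⟩
  -- The tail suprema dominate `Xn n` and decrease to `X`, so continuity from above applies to them
  -- and `ρ (Y n) ≤ ρ (Xn n)`.
  have hY : ∀ n, ∃ Y : Linfty P, Y =ᵐ[P] fun ω => ⨆ m, Xn (n + m) ω := by
    intro n
    refine exists_linfty_of_ae_abs_le (C := R) ?_ ?_
    · exact (Measurable.iSup fun m => (Lp.stronglyMeasurable _).measurable).aestronglyMeasurable
    · filter_upwards [hb] with ω hω
      exact abs_le.2 ⟨(abs_le.1 (hω _)).1.trans (le_ciSup (hbdd ω hω n) 0),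
        ciSup_le fun m => (abs_le.1 (hω _)).2⟩
  choose Y hY using hY
  have hYX : ∀ n, Xn n ≤ Y n := by
    intro n
    rw [← Lp.coeFn_le]
    filter_upwards [hb, hY n] with ω hω hn
    rw [hn]
    exact le_ciSup (hbdd ω hω n) 0
  have hlim := h Y X (fun n => by
      rw [← Lp.coeFn_le]
      filter_upwards [hb, hY n, hY (n + 1)] with ω hω h1 h2
      rw [h1, h2]
      refine ciSup_le fun m => ?_
      have := le_ciSup (hbdd ω hω n) (1 + m)
      simpa only [add_assoc] using this) (by
    filter_upwards [hb, ae_all_iff.2 hY, hX] with ω hω hYω hXω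
    rw [Metric.tendsto_atTop] at hXω ⊢
    intro ε hε
    obtain ⟨N, hN⟩ := hXω (ε / 2) (half_pos hε)
    refine ⟨N, fun n hn => ?_⟩
    rw [hYω, Real.dist_eq, abs_lt]
    have h1 := abs_lt.1 (Real.dist_eq _ _ ▸ hN n hn)
    have h2 : Xn n ω ≤ ⨆ m, Xn (n + m) ω := le_ciSup (hbdd ω hω n) 0
    have h3 : ⨆ m, Xn (n + m) ω ≤ X ω + ε / 2 := ciSup_le fun m => by
      have := abs_lt.1 (Real.dist_eq _ _ ▸ hN (n + m) (by omega))
      linarith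
    constructor <;> linarith)
  exact le_of_tendsto_of_tendsto' hlim hcn fun n => (hmono _ _ (hYX n)).trans (hc n)

/-! ### Passage to L^2 -/

/-- The inclusion of `L^∞` into `L^2`. -/
def toL2 (P : Measure Ω) [IsFiniteMeasure P] : Linfty P →ₗ[ℝ] Lp ℝ 2 P where
  toFun X := ((Lp.memLp X).mono_exponent le_top).toLp X
  map_add' X Y := by
    rw [← MemLp.toLp_add]
    exact MemLp.toLp_congr _ _ (Lp.coeFn_add X Y)
  map_smul' a X := by
    rw [RingHom.id_apply, ← MemLp.toLp_const_smul]
    exact MemLp.toLp_congr _ _ (Lp.coeFn_smul a X)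

theorem coeFn_toL2 (P : Measure Ω) [IsFiniteMeasure P] (X : Linfty P) : toL2 P X =ᵐ[P] X :=
  ((Lp.memLp X).mono_exponent le_top).coeFn_toLp

theorem norm_toL2_le (P : Measure Ω) [IsProbabilityMeasure P] (X : Linfty P) :
    ‖toL2 P X‖ ≤ ‖X‖ := by
  have := Lp.norm_le_of_ae_bound (f := toL2 P X) (norm_nonneg X) (by
    filter_upwards [coeFn_toL2 P X, ae_abs_le_norm X] with ω h1 h2
    rwa [h1])
  simpa [measureUnivNNReal] using this

theorem exists_inner_toL2_eq_pairing (P : Measure Ω) [IsFiniteMeasure P] (z : Lp ℝ 2 P) :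
    ∃ Z : Lp ℝ 1 P, ∀ X, inner ℝ z (toL2 P X) = pairing P X Z := by
  have hz : MemLp z 1 P := (Lp.memLp z).mono_exponent (by norm_num)
  refine ⟨hz.toLp z, fun X => ?_⟩
  rw [L2.inner_def, pairing_apply]
  refine integral_congr_ae ?_
  filter_upwards [coeFn_toL2 P X, hz.coeFn_toLp] with ω h1 h2
  simp [h1, h2]

/-- The norm of `L^1` is determined by the pairing with `L^∞`. -/
theorem norm_le_of_pairing_le {P : Measure Ω} {Z : Lp ℝ 1 P} {η : ℝ}
    (h : ∀ X : Linfty P, pairing P X Z ≤ η * ‖X‖) (hη : 0 ≤ η) : ‖Z‖ ≤ η := by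
  obtain ⟨S, hS⟩ := exists_linfty_of_ae_abs_le (P := P) (f := fun ω => SignType.sign (Z ω))
    (C := 1) (by
      have : Measurable fun x : ℝ => ((SignType.sign x : SignType) : ℝ) := by
        have hs : (fun x : ℝ => ((SignType.sign x : SignType) : ℝ)) =
            fun x => if 0 < x then 1 else if x < 0 then -1 else 0 := by
          funext x
          rw [sign_apply]
          split_ifs <;> simp
        rw [hs]
        exact Measurable.ite measurableSet_Ioi measurable_const
          (Measurable.ite measurableSet_Iio measurable_const measurable_const)
      exact (this.comp (Lp.stronglyMeasurable Z).measurable).aestronglyMeasurable)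
    (ae_of_all _ fun ω => by
      rcases lt_trichotomy (Z ω) 0 with h | h | h <;> simp [h])
  have hS1 : ‖S‖ ≤ 1 := norm_le_of_ae_abs_le zero_le_one (by
    filter_upwards [hS] with ω hω
    rw [hω]
    rcases lt_trichotomy (Z ω) 0 with h | h | h <;> simp [h])
  have hp : pairing P S Z = ‖Z‖ := by
    rw [pairing_apply, L1.norm_eq_integral_norm]
    refine integral_congr_ae ?_
    filter_upwards [hS] with ω hω
    rw [hω, Real.norm_eq_abs, sign_mul_self]
  rw [← hp]
  exact (h S).trans (mul_le_of_le_one_right hη hS1)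

theorem ae_tendsto_subseq_of_toL2 {P : Measure Ω} [IsFiniteMeasure P] {Xn : ℕ → Linfty P}
    {p : Lp ℝ 2 P} (h : Tendsto (fun n => toL2 P (Xn n)) atTop (𝓝 p)) :
    ∃ σ : ℕ → ℕ, StrictMono σ ∧ ∀ᵐ ω ∂P, Tendsto (fun n => Xn (σ n) ω) atTop (𝓝 (p ω)) := by
  obtain ⟨σ, hσ, hl⟩ := (tendstoInMeasure_of_tendsto_Lp h).exists_seq_tendsto_ae
  refine ⟨σ, hσ, ?_⟩
  filter_upwards [hl, ae_all_iff.2 fun n => coeFn_toL2 P (Xn (σ n))] with ω h1 h2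
  exact h1.congr h2

/-! ### Krein–Šmulian argument by separation in L^2 -/

/-- If `f + η‖·‖ + c` is positive on a ball, then `f X + η‖Y‖ + c` and the `L^2`-distance of `X`
and `Y` cannot be small simultaneously. -/
theorem exists_pos_le_dist {P : Measure Ω} [IsProbabilityMeasure P] {f : Linfty P → ℝ}
    (hconv : ConvexOn ℝ Set.univ f) (hlsc : BoundedLSC P f) {R η c : ℝ} (hη : 0 ≤ η)
    (h : ∀ X : Linfty P, ‖X‖ ≤ R → 0 < f X + η * ‖X‖ + c) :
    ∃ δ > 0, ∀ X Y : Linfty P, ‖X‖ ≤ R → f X + η * ‖Y‖ + c < δ →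
      δ ≤ ‖toL2 P X - toL2 P Y‖ := by
  by_contra! hcon
  let S : ℕ → Set (Lp ℝ 2 P) := fun n => {v | ∃ X Y : Linfty P, v = toL2 P X ∧ ‖X‖ ≤ R ∧
    f X + η * ‖Y‖ + c < 1 / (n + 1) ∧ ‖toL2 P X - toL2 P Y‖ < 1 / (n + 1)}
  have hSc : ∀ n, Convex ℝ (S n) := by
    rintro n _ ⟨X, Y, rfl, h1, h2, h3⟩ _ ⟨X', Y', rfl, h1', h2', h3'⟩ a b ha hb hab
    refine ⟨a • X + b • X', a • Y + b • Y', by simp, ?_, ?_, ?_⟩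
    · have := (convex_closedBall (0 : Linfty P) R) (mem_closedBall_zero_iff.2 h1)
        (mem_closedBall_zero_iff.2 h1') ha hb hab
      exact mem_closedBall_zero_iff.1 this
    · have e1 : f (a • X + b • X') ≤ a * f X + b * f X' :=
        hconv.2 (Set.mem_univ X) (Set.mem_univ X') ha hb hab
      have e2 : ‖a • Y + b • Y'‖ ≤ a * ‖Y‖ + b * ‖Y'‖ :=
        convexOn_univ_norm.2 (Set.mem_univ Y) (Set.mem_univ Y') ha hb hab
      have e3 := mul_le_mul_of_nonneg_left e2 hη
      have e4 : a * (f X + η * ‖Y‖ + c) + b * (f X' + η * ‖Y'‖ + c) < 1 / ((n : ℝ) + 1) :=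
        convex_Iio (𝕜 := ℝ) (1 / ((n : ℝ) + 1)) h2 h2' ha hb hab
      have : a * c + b * c = c := by rw [← add_mul, hab, one_mul]
      nlinarith
    · have := (convex_ball (0 : Lp ℝ 2 P) (1 / ((n : ℝ) + 1))) (mem_ball_zero_iff.2 h3)
        (mem_ball_zero_iff.2 h3') ha hb hab
      have he : toL2 P (a • X + b • X') - toL2 P (a • Y + b • Y') =
          a • (toL2 P X - toL2 P Y) + b • (toL2 P X' - toL2 P Y') := by
        simp only [map_add, map_smul, smul_sub]
        abel
      rw [he]
      exact mem_ball_zero_iff.1 this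
  have hSne : ∀ n, (S n).Nonempty := by
    intro n
    obtain ⟨X, Y, h1, h2, h3⟩ := hcon (1 / (n + 1)) (by positivity)
    exact ⟨_, X, Y, rfl, h1, h2, h3⟩
  have hSa : Antitone S := by
    rintro n m hnm _ ⟨X, Y, rfl, h1, h2, h3⟩
    have : 1 / ((m : ℝ) + 1) ≤ 1 / (n + 1) := by gcongr
    exact ⟨X, Y, rfl, h1, h2.trans_le this, h3.trans_le this⟩
  obtain ⟨p, hp⟩ := exists_mem_iInter_closure_of_convex S hSc hSne hSa R (by
    rintro _ ⟨X, Y, rfl, h1, h2, h3⟩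
    exact (norm_toL2_le P X).trans h1)
  have hseq : ∀ n : ℕ, ∃ X Y : Linfty P, dist p (toL2 P X) < 1 / (n + 1) ∧ ‖X‖ ≤ R ∧
      f X + η * ‖Y‖ + c < 1 / (n + 1) ∧ ‖toL2 P X - toL2 P Y‖ < 1 / (n + 1) := by
    intro n
    obtain ⟨_, ⟨X, Y, rfl, h1⟩, h2⟩ := Metric.mem_closure_iff.1 (hp n) (1 / (n + 1)) (by positivity)
    exact ⟨X, Y, h2, h1⟩
  choose X Y hXp hXR hXY hd using hseq
  have h0 := tendsto_one_div_add_atTop_nhds_zero_nat (𝕜 := ℝ)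
  have hX : Tendsto (fun n => toL2 P (X n)) atTop (𝓝 p) := by
    rw [tendsto_iff_dist_tendsto_zero]
    exact squeeze_zero (fun _ => dist_nonneg) (fun n => (dist_comm _ _).trans_le (hXp n).le) h0
  have hY : Tendsto (fun n => toL2 P (Y n)) atTop (𝓝 p) := by
    have : Tendsto (fun n => toL2 P (X n) - toL2 P (Y n)) atTop (𝓝 0) :=
      squeeze_zero_norm (fun n => (hd n).le) h0
    simpa using hX.sub this
  obtain ⟨φ, hφ, hXφ⟩ := ae_tendsto_subseq_of_toL2 hX
  obtain ⟨ψ, hψ, hYψ⟩ := ae_tendsto_subseq_of_toL2 (hY.comp hφ.tendsto_atTop)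
  have hσ := hφ.comp hψ
  -- As an a.e. limit of functions bounded by `R`, the L^2-limit `p` lies in L^∞.
  obtain ⟨V, hV⟩ := exists_linfty_of_ae_abs_le (P := P) (f := p) (C := R)
    (Lp.aestronglyMeasurable p) (by
      filter_upwards [hXφ, ae_all_iff.2 fun n => ae_abs_le_norm (X n)] with ω h1 h2
      exact le_of_tendsto' h1.abs fun n => (h2 _).trans (hXR _))
  have hXV : ∀ᵐ ω ∂P, Tendsto (fun n => X (φ (ψ n)) ω) atTop (𝓝 (V ω)) := by
    filter_upwards [hXφ, hV] with ω h1 h2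
    rw [h2]
    exact h1.comp hψ.tendsto_atTop
  have hYV : ∀ᵐ ω ∂P, Tendsto (fun n => Y (φ (ψ n)) ω) atTop (𝓝 (V ω)) := by
    filter_upwards [hYψ, hV] with ω h1 h2
    rw [h2]
    exact h1
  have hR : 0 ≤ R := (norm_nonneg _).trans (hXR 0)
  have hVR : ‖V‖ ≤ R := norm_le_of_ae_abs_le hR (by
    filter_upwards [hXV, ae_all_iff.2 fun n => ae_abs_le_norm (X n)] with ω h1 h2
    exact le_of_tendsto' h1.abs fun n => (h2 _).trans (hXR _))
  have hpos := h V hVR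
  set γ := f V + η * ‖V‖ + c with hγ
  -- The level `s` is below `‖V‖`, yet `η * (‖V‖ - s) ≤ γ / 2`; the `+ 1` covers `η = 0`. If the
  -- norms of the `Y`'s eventually exceed `s`, the Fatou property gives `γ ≤ γ / 2`; otherwise `‖V‖
  -- ≤ s` in the limit.
  set s := ‖V‖ - γ / (2 * (η + 1)) with hs
  have hγη : 0 < γ / (2 * (η + 1)) := by positivity
  by_cases hev : ∀ᶠ n in atTop, s < ‖Y (φ (ψ n))‖
  · obtain ⟨N, hN⟩ := eventually_atTop.1 hev
    have hle : f V ≤ 0 - c - η * s := by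
      refine hlsc R (fun n => X (φ (ψ (n + N)))) V (fun n => 1 / ((n : ℝ) + 1) - c - η * s) _
        (fun n => hXR _) ?_ (fun n => ?_) ((h0.sub_const c).sub_const _)
      · filter_upwards [hXV] with ω hω using hω.comp (tendsto_add_atTop_nat N)
      · have h1 := hXY (φ (ψ (n + N)))
        have h2 := mul_le_mul_of_nonneg_left (hN (n + N) (by omega)).le hη
        have h3 : 1 / ((φ (ψ (n + N)) : ℝ) + 1) ≤ 1 / ((n : ℝ) + 1) := by
          have : n ≤ φ (ψ (n + N)) := (Nat.le_add_right n N).trans (hσ.le_apply)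
          gcongr
        linarith
    have h4 : η * (γ / (2 * (η + 1))) ≤ γ / 2 := by
      rw [mul_div_assoc', div_le_div_iff₀ (by positivity) two_pos]
      nlinarith
    have h5 : η * s = η * ‖V‖ - η * (γ / (2 * (η + 1))) := by rw [hs, mul_sub]
    linarith
  · rw [not_eventually] at hev
    have hfr : ∃ᶠ n in atTop, ‖Y (φ (ψ n))‖ ≤ s := hev.mono fun n hn => not_lt.1 hn
    obtain ⟨n, hn⟩ := hfr.exists
    have : ‖V‖ ≤ s := norm_le_of_ae_abs_le ((norm_nonneg _).trans hn) (by
      filter_upwards [hYV, ae_all_iff.2 fun n => ae_abs_le_norm (Y n)] with ω h1 h2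
      exact le_of_tendsto_of_frequently h1.abs (hfr.mono fun n hn => (h2 _).trans hn))
    linarith

/-- If `f + η‖·‖ + c` is positive on a ball, then the term `η‖·‖` can be replaced by a linear
functional given by an element of `L^1` of norm at most `η`, keeping nonnegativity. -/
theorem exists_norm_le_forall_nonneg {P : Measure Ω} [IsProbabilityMeasure P] {f : Linfty P → ℝ}
    (hconv : ConvexOn ℝ Set.univ f) (hlsc : BoundedLSC P f) {R η c : ℝ} (hR : 0 ≤ R) (hη : 0 ≤ η)
    (h : ∀ X : Linfty P, ‖X‖ ≤ R → 0 < f X + η * ‖X‖ + c) :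
    ∃ Z : Lp ℝ 1 P, ‖Z‖ ≤ η ∧ ∀ X : Linfty P, ‖X‖ ≤ R → 0 ≤ f X + pairing P X Z + c := by
  obtain ⟨δ, hδ, hsep⟩ := exists_pos_le_dist hconv hlsc hη h
  -- The norm is evaluated at an independent copy `Y` of `X`, and the first coordinate records the
  -- mismatch. A functional separating `D` from a ball around 0 prices this mismatch by a single
  -- `Z`, dominating `-f - c` in `X` and dominated by the norm in `Y`.
  let D : Set (Lp ℝ 2 P × ℝ) := {x | ∃ X Y : Linfty P, ‖X‖ ≤ R ∧ x.1 = toL2 P X - toL2 P Y ∧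
    f X + η * ‖Y‖ + c ≤ x.2}
  have hD : Convex ℝ D := by
    rintro ⟨v, t⟩ ⟨X, Y, h1, h2, h3⟩ ⟨v', t'⟩ ⟨X', Y', h1', h2', h3'⟩ a b ha hb hab
    refine ⟨a • X + b • X', a • Y + b • Y', ?_, ?_, ?_⟩
    · have := (convex_closedBall (0 : Linfty P) R) (mem_closedBall_zero_iff.2 h1)
        (mem_closedBall_zero_iff.2 h1') ha hb hab
      exact mem_closedBall_zero_iff.1 this
    · simp only at h2 h2'
      simp only [Prod.smul_mk, Prod.mk_add_mk, map_add, map_smul, h2, h2', smul_sub]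
      abel
    · have e1 : f (a • X + b • X') ≤ a * f X + b * f X' :=
        hconv.2 (Set.mem_univ X) (Set.mem_univ X') ha hb hab
      have e2 : ‖a • Y + b • Y'‖ ≤ a * ‖Y‖ + b * ‖Y'‖ :=
        convexOn_univ_norm.2 (Set.mem_univ Y) (Set.mem_univ Y') ha hb hab
      have e3 := mul_le_mul_of_nonneg_left e2 hη
      have e4 := mul_le_mul_of_nonneg_left h3 ha
      have e5 := mul_le_mul_of_nonneg_left h3' hb
      simp only [smul_eq_mul, Prod.smul_mk, Prod.mk_add_mk] at e4 e5 ⊢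
      have : a * c + b * c = c := by rw [← add_mul, hab, one_mul]
      nlinarith
  have hdisj : Disjoint (Metric.ball (0 : Lp ℝ 2 P × ℝ) δ) D := by
    rw [Set.disjoint_left]
    rintro ⟨v, t⟩ hb ⟨X, Y, h1, h2, h3⟩
    rw [mem_ball_zero_iff, Prod.norm_def, max_lt_iff] at hb
    have h4 := hsep X Y h1 (h3.trans_lt ((le_abs_self _).trans_lt hb.2))
    rw [← h2] at h4
    exact absurd hb.1 (not_lt.2 h4)
  obtain ⟨φ, u, hφ, hu⟩ :=
    geometric_hahn_banach_open (convex_ball _ _) Metric.isOpen_ball hD hdisj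
  have hu0 : 0 < u := by simpa using hφ 0 (Metric.mem_ball_self hδ)
  set lam := φ (0, 1) with hlam
  have hφ' : ∀ v t, φ (v, t) = φ (v, 0) + t * lam := by
    intro v t
    have : ((v, t) : Lp ℝ 2 P × ℝ) = (v, 0) + t • (0, 1) := by simp
    rw [this, map_add, map_smul, smul_eq_mul]
  have hD' : ∀ (X Y : Linfty P) t, ‖X‖ ≤ R → f X + η * ‖Y‖ + c ≤ t →
      u ≤ φ (toL2 P X, 0) - φ (toL2 P Y, 0) + t * lam := by
    intro X Y t h1 h2
    have h3 := hu (toL2 P X - toL2 P Y, t) ⟨X, Y, h1, rfl, h2⟩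
    have h4 : φ (toL2 P X - toL2 P Y, (0 : ℝ)) = φ (toL2 P X, 0) - φ (toL2 P Y, 0) := by
      rw [← map_sub φ, Prod.mk_sub_mk, sub_zero]
    rw [hφ', h4] at h3
    exact h3
  have hlam0 : 0 < lam := by
    -- Points of `D` over the origin exclude a vertical separating hyperplane.
    have h1 := hD' 0 0 (max (f 0 + η * ‖(0 : Linfty P)‖ + c) 0) (by simpa using hR)
      (le_max_left _ _)
    simp only [sub_self, zero_add] at h1
    exact pos_of_mul_pos_right (hu0.trans_le h1) (le_max_right _ _)
  let ψ : Lp ℝ 2 P →L[ℝ] ℝ := φ.comp (ContinuousLinearMap.inl ℝ (Lp ℝ 2 P) ℝ)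
  have hψ : ∀ X, φ (toL2 P X, 0) = ψ (toL2 P X) := fun X => rfl
  obtain ⟨Z, hZ⟩ := exists_inner_toL2_eq_pairing P
    (lam⁻¹ • (InnerProductSpace.toDual ℝ (Lp ℝ 2 P)).symm ψ)
  have hZφ : ∀ X, φ (toL2 P X, 0) = lam * pairing P X Z := by
    intro X
    rw [← hZ, inner_smul_left, InnerProductSpace.toDual_symm_apply, hψ]
    simp [hlam0.ne']
  have hmain : ∀ X Y : Linfty P, ‖X‖ ≤ R →
      0 ≤ f X + pairing P X Z + c + (η * ‖Y‖ - pairing P Y Z) := by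
    intro X Y hX
    have h1 := hD' X Y _ hX le_rfl
    rw [hZφ, hZφ] at h1
    refine le_of_mul_le_mul_left ?_ hlam0
    nlinarith
  refine ⟨Z, norm_le_of_pairing_le (fun Y => ?_) hη, fun X hX => by simpa using hmain X 0 hX⟩
  by_contra! hlt
  set A := f 0 + pairing P 0 Z + c with hA
  -- If `Z` exceeded `η‖·‖` at `Y`, this multiple of `Y` would give `0 ≤ A - (|A| + 1)`.
  have h1 := hmain 0 (((|A| + 1) / (pairing P Y Z - η * ‖Y‖)) • Y) (by simpa using hR)
  have hpos : 0 < pairing P Y Z - η * ‖Y‖ := sub_pos.2 hlt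
  rw [norm_smul, Real.norm_of_nonneg (by positivity), map_smul, LinearMap.smul_apply, smul_eq_mul,
    ← hA] at h1
  have h2 : (|A| + 1) / (pairing P Y Z - η * ‖Y‖) * (pairing P Y Z - η * ‖Y‖) = |A| + 1 :=
    div_mul_cancel₀ _ hpos.ne'
  have h3 := le_abs_self A
  linarith

/-- Krein–Šmulian type theorem: a convex functional with the Fatou property is approximately
supported at `0` by an element of `L^1`. -/
theorem exists_forall_le_add_pairing {P : Measure Ω} [IsProbabilityMeasure P] {f : Linfty P → ℝ}
    (hconv : ConvexOn ℝ Set.univ f) (hlsc : BoundedLSC P f) (h0 : f 0 = 0)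
    (hnorm : ∀ X, -‖X‖ ≤ f X) {ε : ℝ} (hε : 0 < ε) :
    ∃ Z : Lp ℝ 1 P, ∀ X : Linfty P, -(2 * ε) ≤ f X + pairing P X Z := by
  -- Radii double while the errors increase from `ε` towards `2ε`; each increment is the slack
  -- needed for strict positivity, and the corrections to `Z` are summable in L^1.
  let Good : ℕ → Lp ℝ 1 P → Prop := fun k Z => ∀ X : Linfty P, ‖X‖ ≤ ε * 2 ^ k →
    -(ε * (2 - (1 / 2) ^ k)) ≤ f X + pairing P X Z
  have hstep : ∀ k Z, Good k Z → ∃ Z', Good (k + 1) Z' ∧ dist Z Z' ≤ 2 * (1 / 2) ^ k := by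
    intro k Z hZ
    have hgc : ConvexOn ℝ Set.univ fun X => f X + pairing P X Z :=
      hconv.add (((pairing P).flip Z).convexOn convex_univ)
    have hq : (0 : ℝ) < (1 / 2) ^ k := by positivity
    have hqk : (1 / 2 : ℝ) ^ k * 2 ^ k = 1 := by rw [← mul_pow]; norm_num
    -- Outside the ball, convexity and the value 0 at the origin compare `X` with its rescaling to
    -- the sphere of radius `ε * 2 ^ k`. The loss per unit norm is at most `2ε / (ε * 2 ^ k)`, hence
    -- the slope.
    have hlow : ∀ X : Linfty P,
        -(ε * (2 - (1 / 2) ^ k)) ≤ f X + pairing P X Z + 2 * (1 / 2) ^ k * ‖X‖ := by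
      intro X
      rcases le_or_gt ‖X‖ (ε * 2 ^ k) with hX | hX
      · have h1 := hZ X hX
        have h2 : 0 ≤ 2 * (1 / 2) ^ k * ‖X‖ := by positivity
        linarith
      · have hr : 0 < ε * 2 ^ k := by positivity
        have hXp : 0 < ‖X‖ := hr.trans hX
        set t := ε * 2 ^ k / ‖X‖ with ht
        have ht0 : 0 < t := by positivity
        have ht1 : t ≤ 1 := (div_le_one hXp).2 hX.le
        have htX : t * ‖X‖ = ε * 2 ^ k := div_mul_cancel₀ _ hXp.ne'
        have h1 := hZ (t • X) (by rw [norm_smul, Real.norm_of_nonneg ht0.le, htX])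
        have h2 := hgc.2 (Set.mem_univ X) (Set.mem_univ 0) ht0.le (sub_nonneg.2 ht1) (by ring)
        simp only [smul_zero, add_zero, map_zero, LinearMap.zero_apply, h0, smul_eq_mul] at h2
        have h3 : 0 ≤ t * (f X + pairing P X Z + 2 * (1 / 2) ^ k * ‖X‖) := by
          have h4 : t * (2 * (1 / 2) ^ k * ‖X‖) = 2 * ε := by
            calc t * (2 * (1 / 2) ^ k * ‖X‖) = 2 * (1 / 2) ^ k * (t * ‖X‖) := by ring
              _ = 2 * ε * ((1 / 2) ^ k * 2 ^ k) := by rw [htX]; ring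
              _ = 2 * ε := by rw [hqk, mul_one]
          have h5 : 0 < ε * (1 / 2) ^ k := by positivity
          linarith
        have h6 := nonneg_of_mul_nonneg_right h3 ht0
        have h7 : (1 / 2 : ℝ) ^ k ≤ 1 := pow_le_one₀ (by norm_num) (by norm_num)
        nlinarith
    obtain ⟨W, hW, hWX⟩ := exists_norm_le_forall_nonneg hgc (hlsc.add_pairing Z)
      (R := ε * 2 ^ (k + 1)) (η := 2 * (1 / 2) ^ k) (c := ε * (2 - (1 / 2) ^ (k + 1)))
      (by positivity) (by positivity) fun X _ => by
        have h1 := hlow X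
        have h2 : 0 < ε * (1 / 2) ^ k := by positivity
        have h3 : ε * (2 - (1 / 2) ^ (k + 1)) = ε * (2 - (1 / 2) ^ k) + ε * (1 / 2) ^ k / 2 := by
          rw [pow_succ]; ring
        linarith
    refine ⟨Z + W, fun X hX => ?_, by simpa [dist_eq_norm] using hW⟩
    have h1 := hWX X hX
    rw [map_add]
    linarith
  choose next hnext hdist using hstep
  let u : (k : ℕ) → {Z // Good k Z} := fun k => Nat.rec
    ⟨0, fun X hX => by
      have h1 := hnorm X
      simp only [pow_zero, mul_one, map_zero] at hX ⊢
      linarith⟩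
    (fun k Z => ⟨next k Z.1 Z.2, hnext k Z.1 Z.2⟩) k
  obtain ⟨Z, hZ⟩ := cauchySeq_tendsto_of_complete
    (cauchySeq_of_le_geometric (1 / 2) 2 (f := fun k => (u k).1) (by norm_num)
      fun k => hdist k (u k).1 (u k).2)
  refine ⟨Z, fun X => ?_⟩
  have hlim := ((continuous_pairing_right P X).tendsto Z).comp hZ
  refine ge_of_tendsto (hlim.const_add (f X)) ?_
  have h2 : Tendsto (fun k : ℕ => ε * 2 ^ k) atTop atTop :=
    (tendsto_pow_atTop_atTop_of_one_lt one_lt_two).const_mul_atTop hε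
  filter_upwards [h2.eventually_ge_atTop ‖X‖] with k hk
  have h3 := (u k).2 X hk
  have h4 : 0 < ε * (1 / 2) ^ k := by positivity
  simp only [Function.comp_apply]
  linarith

/-! ### Approximate subgradients as densities -/

theorem le_add_norm_sub {P : Measure Ω} [IsFiniteMeasure P] {ρ : Linfty P → ℝ}
    (hmono : ∀ X Y : Linfty P, X ≤ Y → ρ Y ≤ ρ X) (hcash : CashSubadditive P ρ) (X Y : Linfty P) :
    ρ X - ‖Y‖ ≤ ρ (X + Y) := by
  refine (hcash X ‖Y‖ (norm_nonneg _)).trans (hmono _ _ ?_)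
  gcongr
  rw [← Lp.coeFn_le]
  filter_upwards [ae_abs_le_norm Y, Lp.coeFn_const (p := ∞) (μ := P) ‖Y‖] with ω h1 h2
  rw [h2]
  exact (le_abs_self _).trans h1

/-- The Krein–Šmulian bound is applied to `ρ (X + ·) - ρ X`, which vanishes at 0; cash-subadditivity
and monotonicity supply its lower bound by `-‖·‖`. -/
theorem exists_forall_add_pairing_le {P : Measure Ω} [IsProbabilityMeasure P] {ρ : Linfty P → ℝ}
    (hconv : ConvexOn ℝ Set.univ ρ) (hmono : ∀ X Y : Linfty P, X ≤ Y → ρ Y ≤ ρ X)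
    (hcash : CashSubadditive P ρ) (hlsc : BoundedLSC P ρ) (X : Linfty P) {ε : ℝ} (hε : 0 < ε) :
    ∃ Z : Lp ℝ 1 P, ∀ Y, ρ X + pairing P X Z - ε ≤ ρ Y + pairing P Y Z := by
  have hc : ConvexOn ℝ Set.univ fun Y => ρ (X + Y) - ρ X := by
    refine ⟨convex_univ, fun Y _ W _ a b ha hb hab => ?_⟩
    have h1 := hconv.2 (Set.mem_univ (X + Y)) (Set.mem_univ (X + W)) ha hb hab
    have h2 : a • (X + Y) + b • (X + W) = X + (a • Y + b • W) := by
      rw [smul_add, smul_add, add_add_add_comm, ← add_smul, hab, one_smul]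
    rw [h2] at h1
    have h3 : a * ρ X + b * ρ X = ρ X := by rw [← add_mul, hab, one_mul]
    simp only [smul_eq_mul] at h1 ⊢
    linarith
  have hl : BoundedLSC P fun Y => ρ (X + Y) - ρ X := by
    intro R Xn V cn c hR hV hc hcn
    have h1 := hlsc (‖X‖ + R) (fun n => X + Xn n) (X + V) _ _
      (fun n => (norm_add_le _ _).trans (by gcongr; exact hR n)) (by
        filter_upwards [hV, Lp.coeFn_add X V, ae_all_iff.2 fun n => Lp.coeFn_add X (Xn n)]
          with ω h1 h2 h3
        simp only [h2, h3, Pi.add_apply]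
        exact h1.const_add _) (fun n => sub_le_iff_le_add.1 (hc n)) (hcn.add_const _)
    exact sub_le_iff_le_add.2 h1
  obtain ⟨Z, hZ⟩ := exists_forall_le_add_pairing hc hl (by simp)
    (fun Y => by linarith [le_add_norm_sub hmono hcash X Y]) (half_pos hε)
  refine ⟨Z, fun Y => ?_⟩
  have h1 := hZ (Y - X)
  rw [add_sub_cancel, map_sub, LinearMap.sub_apply] at h1
  linarith

theorem nonneg_of_forall_le_mul {K x : ℝ} (h : ∀ t : ℝ, 0 ≤ t → K ≤ t * x) : 0 ≤ x := by
  by_contra! hx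
  have h1 := h ((|K| + 1) / -x) (by have := neg_pos.2 hx; positivity)
  have h2 : (|K| + 1) / -x * x = -(|K| + 1) := by
    rw [div_mul_eq_mul_div, div_neg, mul_div_cancel_right₀ _ hx.ne]
  rw [h2] at h1
  have := neg_abs_le K
  linarith

/-- Since `ρ ≤ 0` on nonnegative multiples `t` of an indicator, `t * ∫_s Z` stays above `K` for all
`t ≥ 0`. -/
theorem ae_nonneg_of_bddBelow {P : Measure Ω} [IsProbabilityMeasure P] {ρ : Linfty P → ℝ}
    (hmono : ∀ X Y : Linfty P, X ≤ Y → ρ Y ≤ ρ X) (hnorm : ρ 0 = 0) {Z : Lp ℝ 1 P} {K : ℝ}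
    (hK : ∀ Y, K ≤ ρ Y + pairing P Y Z) : 0 ≤ᵐ[P] Z := by
  refine ae_nonneg_of_forall_setIntegral_nonneg (L1.integrable_coeFn Z) fun s hs _ => ?_
  obtain ⟨N, hN⟩ := exists_linfty_of_ae_abs_le (P := P) (f := s.indicator 1) (C := 1)
    (measurable_one.indicator hs).aestronglyMeasurable (ae_of_all _ fun ω => by
      by_cases h : ω ∈ s <;> simp [h])
  have hp : pairing P N Z = ∫ ω in s, Z ω ∂P := by
    rw [pairing_apply, ← integral_indicator hs]
    refine integral_congr_ae ?_
    filter_upwards [hN] with ω hω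
    by_cases h : ω ∈ s <;> simp [hω, h]
  rw [← hp]
  refine nonneg_of_forall_le_mul (K := K) fun t ht => ?_
  have h1 : (0 : Linfty P) ≤ t • N := by
    rw [← Lp.coeFn_nonneg]
    filter_upwards [hN, Lp.coeFn_smul t N] with ω h1 h2
    rw [h2, Pi.smul_apply, h1]
    exact smul_nonneg ht (Set.indicator_nonneg (fun _ _ => zero_le_one) _)
  have h2 := hmono _ _ h1
  have h3 := hK (t • N)
  rw [map_smul, LinearMap.smul_apply, smul_eq_mul] at h3
  linarith

/-- Testing on the constant `-t`, where `ρ ≤ t`, bounds `t * (1 - ∫ Z)` below by `K`. -/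
theorem integral_le_one_of_bddBelow {P : Measure Ω} [IsProbabilityMeasure P] {ρ : Linfty P → ℝ}
    (hcash : CashSubadditive P ρ) (hnorm : ρ 0 = 0) {Z : Lp ℝ 1 P} {K : ℝ}
    (hK : ∀ Y, K ≤ ρ Y + pairing P Y Z) : ∫ ω, Z ω ∂P ≤ 1 := by
  rw [← sub_nonneg]
  refine nonneg_of_forall_le_mul (K := K) fun t ht => ?_
  have h1 := hcash (Lp.const ∞ P (-t)) t ht
  rw [← map_add, neg_add_cancel, map_zero, hnorm] at h1
  have h2 := hK (Lp.const ∞ P (-t))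
  have h3 : pairing P (Lp.const ∞ P (-t)) Z = -t * ∫ ω, Z ω ∂P := by
    rw [pairing_apply, ← integral_const_mul]
    refine integral_congr_ae ?_
    filter_upwards [Lp.coeFn_const (p := ∞) (μ := P) (-t)] with ω hω
    rw [hω, Function.const_apply]
  rw [h3] at h2
  linarith

/-- Nonnegative elements of `L^1` of mass at most one are of the form `a dQ/dP`. -/
theorem exists_mem_M1_of_nonneg {P : Measure Ω} [IsProbabilityMeasure P] {Z : Lp ℝ 1 P}
    (hZ : 0 ≤ᵐ[P] Z) (hZ1 : ∫ ω, Z ω ∂P ≤ 1) :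
    ∃ a ∈ Set.Icc (0 : ℝ) 1, ∃ Q ∈ M1 P, ∀ X : Linfty P,
      a * ∫ ω, -(X ω) ∂Q = -pairing P X Z := by
  have hint := L1.integrable_coeFn Z
  rcases (integral_nonneg_of_ae hZ).eq_or_lt with h0 | hpos
  -- Here `Z = 0` a.e.; with `a = 0` any `Q` serves.
  · refine ⟨0, by simp, P, ⟨inferInstance, Measure.AbsolutelyContinuous.rfl⟩, fun X => ?_⟩
    have h1 := (integral_eq_zero_iff_of_nonneg_ae hZ hint).1 h0.symm
    rw [zero_mul, pairing_apply, zero_eq_neg]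
    refine integral_eq_zero_of_ae ?_
    filter_upwards [h1] with ω hω
    simp [hω]
  · set a := ∫ ω, Z ω ∂P with ha
    have hm : Measurable fun ω => (Z ω / a).toNNReal :=
      ((Lp.stronglyMeasurable Z).measurable.div_const a).real_toNNReal
    refine ⟨a, ⟨hpos.le, hZ1⟩, P.withDensity fun ω => ((Z ω / a).toNNReal : ℝ≥0∞),
      ⟨⟨?_⟩, withDensity_absolutelyContinuous _ _⟩, fun X => ?_⟩
    · rw [withDensity_apply _ MeasurableSet.univ, Measure.restrict_univ]
      change ∫⁻ ω, ENNReal.ofReal (Z ω / a) ∂P = 1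
      rw [← ofReal_integral_eq_lintegral_ofReal (hint.div_const a) (by
        filter_upwards [hZ] with ω hω using div_nonneg hω hpos.le), integral_div, ← ha,
        div_self hpos.ne', ENNReal.ofReal_one]
    · rw [integral_withDensity_eq_integral_smul hm, pairing_apply, ← integral_const_mul,
        ← integral_neg]
      refine integral_congr_ae ?_
      filter_upwards [hZ] with ω hω
      rw [NNReal.smul_def, Real.coe_toNNReal _ (div_nonneg hω hpos.le), smul_eq_mul]
      field_simp

theorem exists_integral_neg_eq_pairing {P Q : Measure Ω} [IsProbabilityMeasure P] (hQ : Q ∈ M1 P) :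
    ∃ Z : Lp ℝ 1 P, ∀ X : Linfty P, ∫ ω, -(X ω) ∂Q = pairing P X Z := by
  obtain ⟨hQp, hQP⟩ := hQ
  have hi : Integrable (fun ω => -(Q.rnDeriv P ω).toReal) P := Measure.integrable_toReal_rnDeriv.neg
  refine ⟨hi.toL1 _, fun X => ?_⟩
  rw [← integral_rnDeriv_smul hQP, pairing_apply]
  refine integral_congr_ae ?_
  filter_upwards [hi.coeFn_toL1] with ω hω
  rw [hω, smul_eq_mul]
  ring

theorem minimalPenalty_nonneg {P : Measure Ω} [IsProbabilityMeasure P] {ρ : Linfty P → ℝ}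
    (hnorm : ρ 0 = 0) (a : ℝ) (Q : Measure Ω) :
    0 ≤ minimalPenalty P ρ a Q := by
  refine le_iSup_of_le 0 ?_
  simp [hnorm]

/-! ### The implications -/

theorem ContinuousFromAbove.representedBy {P : Measure Ω} [IsProbabilityMeasure P]
    {ρ : Linfty P → ℝ} (h : ContinuousFromAbove P ρ) (hconv : ConvexOn ℝ Set.univ ρ)
    (hmono : ∀ X Y : Linfty P, X ≤ Y → ρ Y ≤ ρ X) (hcash : CashSubadditive P ρ)
    (hnorm : ρ 0 = 0) : RepresentedBy P ρ (M1 P) (minimalPenalty P ρ) := by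
  refine ⟨fun a _ Q _ => minimalPenalty_nonneg hnorm a Q, fun X => le_antisymm ?_ ?_⟩
  · refine le_of_forall_lt fun y hy => ?_
    obtain ⟨r, hyr, hr⟩ := EReal.lt_iff_exists_real_btwn.1 hy
    refine hyr.trans_le ?_
    -- With `ε = ρ X - r`, the subgradient inequality is exactly a bound on the penalty that leaves
    -- the value `r` at `X`.
    obtain ⟨Z, hZ⟩ := exists_forall_add_pairing_le hconv hmono hcash (h.boundedLSC hmono) X
      (sub_pos.2 (EReal.coe_lt_coe_iff.1 hr))
    obtain ⟨a, ha, Q, hQ, haQ⟩ := exists_mem_M1_of_nonneg (ae_nonneg_of_bddBelow hmono hnorm hZ)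
      (integral_le_one_of_bddBelow hcash hnorm hZ)
    refine le_iSup₂_of_le a ha (le_iSup₂_of_le Q hQ ?_)
    have hc : minimalPenalty P ρ a Q ≤ ((-pairing P X Z - r : ℝ) : EReal) := by
      refine iSup_le fun Y => EReal.coe_le_coe_iff.2 ?_
      rw [haQ]
      linarith [hZ Y]
    rw [haQ]
    refine le_trans ?_ (EReal.sub_le_sub le_rfl hc)
    rw [← EReal.coe_sub, EReal.coe_le_coe_iff]
    linarith
  · refine iSup₂_le fun a _ => iSup₂_le fun Q _ => ?_
    refine (EReal.sub_le_sub le_rfl (le_iSup (fun Y : Linfty P =>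
      ((a * (∫ ω, -(Y ω) ∂Q) - ρ Y : ℝ) : EReal)) X)).trans ?_
    rw [← EReal.coe_sub, sub_sub_cancel]

theorem RepresentedBy.weakStarLSC {P : Measure Ω} [IsProbabilityMeasure P] {ρ : Linfty P → ℝ}
    {𝒬 : Set (Measure Ω)} {c : ℝ → Measure Ω → EReal} (h𝒬 : 𝒬 ⊆ M1 P)
    (h : RepresentedBy P ρ 𝒬 c) : WeakStarLSC P ρ := by
  intro (X : Linfty P) y hy
  have h1 : (y : EReal) < ρ X := EReal.coe_lt_coe_iff.2 hy
  rw [h.2 X] at h1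
  simp only [lt_iSup_iff] at h1
  obtain ⟨a, ha, Q, hQ, h2⟩ := h1
  obtain ⟨Z, hZ⟩ := exists_integral_neg_eq_pairing (h𝒬 hQ)
  have hle : ∀ Y : Linfty P, ((a * pairing P Y Z : ℝ) : EReal) - c a Q ≤ ρ Y := by
    intro Y
    rw [h.2 Y, ← hZ]
    exact le_iSup₂_of_le a ha (le_iSup₂_of_le Q hQ le_rfl)
  rw [hZ] at h2
  have hc0 := h.1 a ha Q hQ
  generalize c a Q = k at h2 hle hc0
  -- Nonnegativity excludes `⊥`, and `⊤` would make the term `⊥`, not above `y`; a real penalty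
  -- gives a weak-star continuous minorant of `ρ` that exceeds `y` at `X`.
  induction k with
  | bot => simp at hc0
  | top => simp at h2
  | coe k =>
    rw [← EReal.coe_sub, EReal.coe_lt_coe_iff] at h2
    have hcont : Continuous fun Y : WeakBilin (pairing P) => a * pairing P Y Z - k :=
      (continuous_const.mul (WeakBilin.eval_continuous (pairing P) Z)).sub continuous_const
    filter_upwards [hcont.continuousAt.eventually (lt_mem_nhds h2)] with Y hY
    have := hle Y
    rw [← EReal.coe_sub, EReal.coe_le_coe_iff] at this
    exact hY.trans_le this

theorem WeakStarLSC.continuousFromAbove {P : Measure Ω} {ρ : Linfty P → ℝ} (h : WeakStarLSC P ρ)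
    (hmono : ∀ X Y : Linfty P, X ≤ Y → ρ Y ≤ ρ X) : ContinuousFromAbove P ρ := by
  intro Xn X hanti hX
  have hae : ∀ᵐ ω ∂P, Antitone fun n => Xn n ω := by
    filter_upwards [ae_all_iff.2 fun n => (Lp.coeFn_le _ _).2 (hanti n)] with ω hω
    exact antitone_nat_of_succ_le hω
  have hXle : ∀ n, X ≤ Xn n := by
    intro n
    rw [← Lp.coeFn_le]
    filter_upwards [hae, hX] with ω h1 h2 using h1.le_of_tendsto h2 n
  have hbd : ∀ n, ∀ᵐ ω ∂P, |Xn n ω| ≤ ‖Xn 0‖ + ‖X‖ := by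
    intro n
    filter_upwards [hae, hX, ae_abs_le_norm (Xn 0), ae_abs_le_norm X] with ω h1 h2 h3 h4
    have h5 := h1.le_of_tendsto h2 n
    have h6 := h1 (Nat.zero_le n)
    have h7 := norm_nonneg X
    have h8 := norm_nonneg (Xn 0)
    rw [abs_le] at h3 h4 ⊢
    constructor <;> linarith
  have hw : Tendsto (β := WeakBilin (pairing P)) Xn atTop
      (@nhds (WeakBilin (pairing P)) _ X) := by
    have hind : IsInducing fun (Y : WeakBilin (pairing P)) Z => pairing P Y Z := ⟨rfl⟩
    exact hind.tendsto_nhds_iff.2 (tendsto_pi_nhds.2 (tendsto_pairing hbd hX))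
  -- Semicontinuity handles lower bounds; `X ≤ Xn n` gives `ρ (Xn n) ≤ ρ X` for the upper ones.
  rw [tendsto_order]
  refine ⟨fun y hy => hw.eventually (h X y hy), fun y hy => Eventually.of_forall fun n => ?_⟩
  exact (hmono _ _ (hXle n)).trans_lt hy

end RiskMeasure

end

theorem theorem3p1 {Ω : Type*} [MeasurableSpace Ω] (P : Measure Ω) [IsProbabilityMeasure P]
    (ρ : RiskMeasure.Linfty P → ℝ)
    (hconv : ConvexOn ℝ Set.univ ρ)
    (hmono : ∀ X Y : RiskMeasure.Linfty P, X ≤ Y → ρ Y ≤ ρ X)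
    (hcash : RiskMeasure.CashSubadditive P ρ)
    (hnorm : ρ 0 = 0) :
    List.TFAE [
      RiskMeasure.ContinuousFromAbove P ρ,
      RiskMeasure.WeakStarLSC P ρ,
      ∃ 𝒬 ⊆ RiskMeasure.M1 P, RiskMeasure.RepresentedBy P ρ 𝒬 (RiskMeasure.minimalPenalty P ρ),
      ∃ 𝒬 ⊆ RiskMeasure.M1 P, ∃ c : ℝ → Measure Ω → EReal,
        RiskMeasure.RepresentedBy P ρ 𝒬 c] := by
  tfae_have 1 → 3 := fun h =>
    ⟨RiskMeasure.M1 P, subset_rfl, h.representedBy hconv hmono hcash hnorm⟩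
  tfae_have 3 → 4 := fun ⟨𝒬, h𝒬, h⟩ => ⟨𝒬, h𝒬, _, h⟩
  tfae_have 4 → 2 := fun ⟨_, h𝒬, _, h⟩ => h.weakStarLSC h𝒬
  tfae_have 2 → 1 := fun h => h.continuousFromAbove hmono
  tfae_finish
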